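/- Let $K$ be a field, let $P=K[x_1,\dots,x_n]$ be a polynomial ring with indeterminates $X=(x_1,\dots,x_n)$, and let $\mathfrak M=\langle x_1,\dots,x_n\rangle$. Let $Z=(z_1,\dots,z_s)$ be a tuple of pairwise distinct indeterminates in $X$, let $\widehat P=K[X\setminus Z]\subseteq P$ be the polynomial ring in the remaining indeterminates, and let $I\subseteq\mathfrak M$ be an ideal of $P$. For a term ordering $\sigma$ (on the monomials of $P$) and an ideal $J$ of $P$, let $\mathrm{LT}_\sigma(J)$ be the ideal generated by the leading terms of the nonzero elements of $J$. A term ordering $\sigma$ is called *$Z$-separating for $I$* if there are $f_1,\dots,f_s\in I\setminus\{0\}$ with $\mathrm{LT}_\sigma(\langle f_1,\dots,f_s\rangle)=\langle z_1,\dots,z_s\rangle$, and $I$ is called *$Z$-separating* if such a $\sigma$ exists. For such a $\sigma$, the reduced $\sigma$-Gröbner basis of $I$ has the form $\{z_1-h_1,\dots,z_s-h_s,\,g_1,\dots,g_t\}$ with $h_i,g_j\in\widehat P$, and the *$Z$-separating re-embedding of $I$* is the $K$-algebra homomorphism $\Phi:P/I\to\widehat P/(I\cap\widehat P)$ with $\Phi(\bar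 x_i)=\bar x_i$ for $x_i\notin Z$ and $\Phi(\bar z_j)=\bar h_j$ for $j=1,\dots,s$. Let $\mathrm{Lin}_{\mathfrak M}(I)$ be the $K$-vector space spanned by the homogeneous components of degree one of the elements of $I$. **Proposition (Affine Space Criterion).** Assume that 1. the ideal $I$ is $Z$-separating, 2. the ring $P_{\mathfrak M}/I_{\mathfrak M}$ is a regular local ring, 3. $\dim_K \mathrm{Lin}_{\mathfrak M}(I)=s$. Then the following hold. (a) $s=n-\dim(P_{\mathfrak M}/I_{\mathfrak M})$. (b) $I\cap\widehat P=\{0\}$. In particular, there is an isomorphism of $K$-algebras $\Phi:P/I\to\widehat P=K[X\setminus Z]$ which, under the identification $\widehat P=\widehat P/(I\cap\widehat P)$, is the $Z$-separating re-embedding of $I$ obtained from any $Z$-separating term ordering $\sigma$ for $I$. Hence $P/I$ is isomorphic as a $K$-algebra to a polynomial ring in $n-s$ indeterminates over $K$, and the scheme $\mathrm{Spec}(P/I)$ is isomorphic over $K$ to the $(n-s)$-dimensional affine space $\mathbb A^{n-s}_K$. -/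

import Mathlib

open MvPolynomial

universe u

noncomputable section

namespace SeparatingIdeal

variable {K : Type*} [Field K] {n s : ℕ}

/-- The ideal `𝔐 = ⟨x₁, …, xₙ⟩` of `K[x₁, …, xₙ]` is prime. -/
instance idealOfVars_isPrime : (idealOfVars (Fin n) K).IsPrime := by
  have h : idealOfVars (Fin n) K =
      RingHom.ker (constantCoeff : MvPolynomial (Fin n) K →+* K) := by
    ext f
    rw [← pow_one (idealOfVars (Fin n) K), mem_pow_idealOfVars_iff', RingHom.mem_ker,
      constantCoeff_eq]
    constructor
    · intro hf
      exact hf 0 (by simp)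
    · intro hf x hx
      have hx0 : x = 0 := by
        rw [Nat.lt_one_iff] at hx
        exact (Finsupp.degree_eq_zero_iff x).1 hx
      rw [hx0, hf]
  rw [h]
  exact RingHom.ker_isPrime _

/-- The ring `P_𝔐 / I_𝔐`: the quotient of the localization of `P = K[x₁, …, xₙ]` at
`𝔐 = ⟨x₁, …, xₙ⟩` by the extension of `I`. -/
abbrev LocalQuotient (I : Ideal (MvPolynomial (Fin n) K)) : Type _ :=
  Localization.AtPrime (idealOfVars (Fin n) K) ⧸
    I.map (algebraMap (MvPolynomial (Fin n) K) (Localization.AtPrime (idealOfVars (Fin n) K)))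

/-- The linear part `Lin_𝔐(I)`: the `K`-span of the homogeneous components of degree one of the
elements of `I` (for an ideal `I` contained in `𝔐`). -/
def linearPart (I : Ideal (MvPolynomial (Fin n) K)) : Submodule K (MvPolynomial (Fin n) K) :=
  Submodule.span K (homogeneousComponent 1 '' (I : Set (MvPolynomial (Fin n) K)))

/-- The leading term ideal `LT_σ(I)`, generated by the leading terms of the elements of `I`. -/
def leadingTermIdeal (σ : MonomialOrder.{0, 0} (Fin n)) (I : Ideal (MvPolynomial (Fin n) K)) :
    Ideal (MvPolynomial (Fin n) K) :=
  Ideal.span (σ.leadingTerm '' (I : Set (MvPolynomial (Fin n) K)))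

/-- `σ` is a `Z`-separating term ordering for `I`, where `Z = (x_{z 0}, …, x_{z (s-1)})`: there are
nonzero polynomials `f₁, …, fₛ ∈ I` such that `LT_σ(⟨f₁, …, fₛ⟩) = ⟨Z⟩`. -/
def IsSeparatingOrder (σ : MonomialOrder.{0, 0} (Fin n)) (z : Fin s → Fin n)
    (I : Ideal (MvPolynomial (Fin n) K)) : Prop :=
  ∃ f : Fin s → MvPolynomial (Fin n) K, (∀ j, f j ∈ I ∧ f j ≠ 0) ∧
    leadingTermIdeal σ (Ideal.span (Set.range f)) = Ideal.span (Set.range fun j => X (z j))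

/-- The ideal `I` is `Z`-separating. -/
def IsSeparating (z : Fin s → Fin n) (I : Ideal (MvPolynomial (Fin n) K)) : Prop :=
  ∃ σ : MonomialOrder.{0, 0} (Fin n), IsSeparatingOrder σ z I

/-- `G` is the reduced `σ`-Gröbner basis of `I`: its elements lie in `I`, are monic, their leading
terms generate `LT_σ(I)`, and no term of an element of `G` is divisible by the leading term of
another element of `G`. -/
structure IsReducedGroebnerBasis (σ : MonomialOrder.{0, 0} (Fin n))
    (I : Ideal (MvPolynomial (Fin n) K)) (G : Set (MvPolynomial (Fin n) K)) : Prop where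
  subset : G ⊆ I
  monic : ∀ g ∈ G, σ.Monic g
  span_leadingTerm : Ideal.span (σ.leadingTerm '' G) = leadingTermIdeal σ I
  reduced : ∀ g ∈ G, ∀ g' ∈ G, g' ≠ g → ∀ t ∈ g.support, ¬ σ.degree g' ≤ t

variable (K) in
/-- The polynomial ring `P̂ = K[X ∖ Z]`, as a subalgebra of `P = K[X]`. -/
abbrev remainingPoly (z : Fin s → Fin n) : Subalgebra K (MvPolynomial (Fin n) K) :=
  supported K (Set.range z)ᶜ

/-- The ideal `I ∩ P̂` of `P̂ = K[X ∖ Z]`. -/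
abbrev elimIdeal (z : Fin s → Fin n) (I : Ideal (MvPolynomial (Fin n) K)) :
    Ideal (remainingPoly K z) :=
  I.comap (remainingPoly K z).val

/-- `Φ : P/I → P̂/(I ∩ P̂)` is the `Z`-separating re-embedding of `I` obtained from the
`Z`-separating term ordering `σ`: the reduced `σ`-Gröbner basis of `I` has the form
`{z₁ - h₁, …, zₛ - hₛ} ∪ g` with `hⱼ ∈ P̂` and `g ⊆ P̂`, and `Φ` sends the class of `xᵢ` to the class
of `xᵢ` for `xᵢ ∉ Z` and the class of `zⱼ` to the class of `hⱼ`. -/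
def IsReembedding (σ : MonomialOrder.{0, 0} (Fin n)) (z : Fin s → Fin n)
    (I : Ideal (MvPolynomial (Fin n) K))
    (Φ : (MvPolynomial (Fin n) K ⧸ I) →ₐ[K] (remainingPoly K z ⧸ elimIdeal z I)) : Prop :=
  ∃ (h : Fin s → remainingPoly K z) (g : Set (remainingPoly K z)),
    IsReducedGroebnerBasis σ I
      ((Set.range fun j => X (z j) - (h j : MvPolynomial (Fin n) K)) ∪ Subtype.val '' g) ∧
    (∀ (i : Fin n) (hi : i ∈ (Set.range z)ᶜ),
      Φ (Ideal.Quotient.mk I (X i)) =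
        Ideal.Quotient.mk (elimIdeal z I) ⟨X i, X_mem_supported.2 hi⟩) ∧
    ∀ j, Φ (Ideal.Quotient.mk I (X (z j))) = Ideal.Quotient.mk (elimIdeal z I) (h j)

end SeparatingIdeal

end

open SeparatingIdeal CategoryTheory AlgebraicGeometry

namespace SeparatingIdeal

variable {K : Type*} [Field K] {n s : ℕ}

/-! The dimension of `P_𝔐 / I_𝔐` is squeezed between two bounds equal to `n - s`. Division by
polynomials `zⱼ - hⱼ ∈ I` with leading term `zⱼ` makes `P̂ → P/I` surjective
(`remainingPolyToQuotient_surjective`), so the dimension is at most `dim P̂ = n - s`. Conversely,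
first order Taylor expansion modulo `Lin_𝔐(I)` shows that the embedding dimension is at least `n -
dim Lin_𝔐(I) = n - s` (`le_finrank_linearPart_add_spanFinrank`), and regularity identifies it with
the dimension. The kernel of `P̂ → P/I` is `I ∩ P̂`; a nonzero element of it would lower the
dimension, as `P̂` is a domain. Hence the surjection is an isomorphism, and its inverse is the
re-embedding for every `σ`. -/

theorem mem_idealOfVars_iff {f : MvPolynomial (Fin n) K} :
    f ∈ idealOfVars (Fin n) K ↔ coeff 0 f = 0 := by
  rw [← pow_one (idealOfVars (Fin n) K), mem_pow_idealOfVars_iff']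
  simp [Finsupp.degree_eq_zero_iff]

/-! ### Division by a family with leading terms `Z`. -/

theorem exists_degree_le_of_mem_leadingTermIdeal {σ : MonomialOrder.{0, 0} (Fin n)}
    {J : Ideal (MvPolynomial (Fin n) K)} {p : MvPolynomial (Fin n) K}
    (hp : p ∈ leadingTermIdeal σ J) {t : Fin n →₀ ℕ} (ht : t ∈ p.support) :
    ∃ g ∈ J, g ≠ 0 ∧ σ.degree g ≤ t := by
  have hle : leadingTermIdeal σ J ≤ Ideal.span ((fun d => monomial d (1 : K)) ''
      (σ.degree '' {g | g ∈ J ∧ g ≠ 0})) := by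
    rw [leadingTermIdeal, Ideal.span_le]
    rintro _ ⟨g, hg, rfl⟩
    by_cases h0 : g = 0
    · simp [h0]
    · have h1 : monomial (σ.degree g) (1 : K) ∈ Ideal.span ((fun d => monomial d (1 : K)) ''
          (σ.degree '' {g | g ∈ J ∧ g ≠ 0})) :=
        Ideal.subset_span ⟨_, ⟨g, ⟨hg, h0⟩, rfl⟩, rfl⟩
      have h2 := Ideal.mul_mem_left _ (C (σ.leadingCoeff g)) h1
      rwa [C_mul_monomial, mul_one] at h2
  obtain ⟨_, ⟨g, ⟨hg, h0⟩, rfl⟩, hgt⟩ := mem_ideal_span_monomial_image.1 (hle hp) t ht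
  exact ⟨g, hg, h0, hgt⟩

theorem mem_remainingPoly_iff {z : Fin s → Fin n} {r : MvPolynomial (Fin n) K} :
    r ∈ remainingPoly K z ↔ ∀ t ∈ r.support, ∀ j, t (z j) = 0 := by
  rw [mem_supported]
  constructor
  · intro h t ht j
    by_contra h0
    exact h ((mem_vars_iff_mem_support _).2 ⟨t, ht, Finsupp.mem_support_iff.2 h0⟩) ⟨j, rfl⟩
  · rintro h i hi ⟨j, rfl⟩
    obtain ⟨t, ht, hit⟩ := (mem_vars_iff_mem_support _).1 hi
    exact Finsupp.mem_support_iff.1 hit (h t ht j)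

/-- No term of the remainder is divisible by a leading term `zⱼ`, so the remainder avoids `Z`. -/
theorem exists_remainder {σ : MonomialOrder.{0, 0} (Fin n)} {z : Fin s → Fin n}
    {b : Fin s → MvPolynomial (Fin n) K} (hb0 : ∀ j, b j ≠ 0)
    (hb : ∀ j, σ.degree (b j) = Finsupp.single (z j) 1) (f : MvPolynomial (Fin n) K) :
    ∃ r : remainingPoly K z, f - r ∈ Ideal.span (Set.range b) := by
  obtain ⟨q, r, hf, -, hr⟩ := σ.div (b := b)
    (fun j => (σ.leadingCoeff_ne_zero_iff.2 (hb0 j)).isUnit) f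
  refine ⟨⟨r, mem_remainingPoly_iff.2 fun t ht j => ?_⟩, ?_⟩
  · have := hr t ht j
    rw [hb, Finsupp.single_le_iff] at this
    omega
  · rw [hf, add_sub_cancel_right]
    exact Finsupp.mem_ideal_span_range_iff_exists_finsupp.2 ⟨q, rfl⟩

/-- The elements `zⱼ - hⱼ` of the reduced Gröbner basis of a `Z`-separating ideal. -/
theorem exists_sub_mem_of_leadingTermIdeal_eq {σ : MonomialOrder.{0, 0} (Fin n)}
    {z : Fin s → Fin n} {J : Ideal (MvPolynomial (Fin n) K)} (hJ : J ≤ idealOfVars (Fin n) K)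
    (hLT : leadingTermIdeal σ J = Ideal.span (Set.range fun j => X (z j))) (j : Fin s) :
    ∃ h : remainingPoly K z, X (z j) - (h : MvPolynomial (Fin n) K) ∈ J ∧
      σ.degree (X (z j) - (h : MvPolynomial (Fin n) K)) = Finsupp.single (z j) 1 ∧
      σ.Monic (X (z j) - (h : MvPolynomial (Fin n) K)) := by
  -- The leading monomial of `g` divides `zⱼ`, and it is not `1` because `g` has no constant term.
  have key : ∀ j, ∃ g ∈ J, g ≠ 0 ∧ σ.degree g = Finsupp.single (z j) 1 := by
    intro j
    have hX : (X (z j) : MvPolynomial (Fin n) K) ∈ leadingTermIdeal σ J :=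
      hLT ▸ Ideal.subset_span ⟨j, rfl⟩
    obtain ⟨g, hg, h0, hle⟩ := exists_degree_le_of_mem_leadingTermIdeal hX
      (t := Finsupp.single (z j) 1) (by simp [X])
    refine ⟨g, hg, h0, ?_⟩
    have hne : σ.degree g ≠ 0 := by
      intro hd
      refine (σ.coeff_degree_ne_zero_iff (f := g)).2 h0 ?_
      rw [hd]
      exact mem_idealOfVars_iff.1 (hJ hg)
    refine le_antisymm hle (Finsupp.single_le_iff.2 (Nat.one_le_iff_ne_zero.2 fun hz => hne ?_))
    ext k
    by_cases hk : k = z j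
    · simpa [hk] using hz
    · simpa [Finsupp.single_apply, Ne.symm hk] using hle k
  choose b hbJ hb0 hb using key
  obtain ⟨r, hr⟩ := exists_remainder hb0 hb (X (z j))
  have hrJ : X (z j) - (r : MvPolynomial (Fin n) K) ∈ J :=
    Ideal.span_le.2 (Set.range_subset_iff.2 hbJ) hr
  have hrz : ∀ t ∈ (r : MvPolynomial (Fin n) K).support, ∀ j, t (z j) = 0 :=
    mem_remainingPoly_iff.1 r.2
  have hcoeff : coeff (Finsupp.single (z j) 1) (X (z j) - (r : MvPolynomial (Fin n) K)) = 1 := by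
    have : coeff (Finsupp.single (z j) 1) (r : MvPolynomial (Fin n) K) = 0 := by
      by_contra h
      simpa using hrz _ (mem_support_iff.2 h) j
    simp [this]
  have h0 : X (z j) - (r : MvPolynomial (Fin n) K) ≠ 0 := by
    intro h
    simp [h] at hcoeff
  -- The leading monomial is divisible by some `z k`. If it were not `z j`, it would be a monomial
  -- of `r`, which avoids `Z`.
  have hdeg : σ.degree (X (z j) - (r : MvPolynomial (Fin n) K)) = Finsupp.single (z j) 1 := by
    have hm : σ.leadingTerm (X (z j) - (r : MvPolynomial (Fin n) K)) ∈
        Ideal.span (X '' Set.range z : Set (MvPolynomial (Fin n) K)) := by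
      rw [← Set.range_comp]
      exact hLT ▸ Ideal.subset_span ⟨_, hrJ, rfl⟩
    obtain ⟨_, ⟨k, rfl⟩, hk⟩ := mem_ideal_span_X_image.1 hm
      (σ.degree (X (z j) - (r : MvPolynomial (Fin n) K)))
      (by rw [σ.support_leadingTerm' h0]; simp)
    have hs := (σ.degree_mem_support_iff _).2 h0
    by_contra hne
    refine hk (hrz _ ?_ k)
    rw [mem_support_iff, coeff_sub, coeff_X, if_neg (Ne.symm hne)] at hs
    rw [mem_support_iff]
    simpa using hs
  exact ⟨r, hrJ, hdeg, by rw [MonomialOrder.Monic, MonomialOrder.leadingCoeff, hdeg, hcoeff]⟩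

end SeparatingIdeal

/-! ### Embedding dimension and the linear part. -/

/-- The maximal ideal maps onto the square-zero ideal `V`, on which `R` acts through `K`; so
generators of the former give a spanning set of `V`. -/
theorem IsLocalRing.finrank_le_spanFinrank_maximalIdeal {R K V : Type*} [CommRing R]
    [IsLocalRing R] [IsNoetherianRing R] [Field K] [AddCommGroup V] [Module K V] [Module Kᵐᵒᵖ V]
    [IsCentralScalar K V] (ψ : R →+* TrivSqZeroExt K V) (hψ : Function.Surjective ψ) :
    Module.finrank K V ≤ (maximalIdeal R).spanFinrank := by
  classical
  obtain ⟨S, hcard, hS⟩ := Submodule.FG.exists_span_finset_card_eq_spanFinrank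
    (IsNoetherian.noetherian (maximalIdeal R))
  have hfst : ∀ r ∈ maximalIdeal R, (ψ r).fst = 0 := by
    intro r hr
    have hsurj : Function.Surjective ((TrivSqZeroExt.fstHom K K V).toRingHom.comp ψ) := by
      rw [RingHom.coe_comp]
      exact Function.Surjective.comp TrivSqZeroExt.fst_surjective hψ
    rw [← IsLocalRing.ker_eq_maximalIdeal _ hsurj] at hr
    exact hr
  have htop : Submodule.span K ((S.image fun r => (ψ r).snd : Finset V) : Set V) = ⊤ := by
    refine eq_top_iff.2 fun v _ => ?_
    obtain ⟨r, hr⟩ := hψ (TrivSqZeroExt.inr v)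
    have hrm : r ∈ maximalIdeal R := by
      rw [mem_maximalIdeal, mem_nonunits_iff]
      intro hu
      have := hu.map ψ
      rw [hr, TrivSqZeroExt.isUnit_inr_iff] at this
      exact not_subsingleton K this
    have hv : (ψ r).snd = v := by rw [hr, TrivSqZeroExt.snd_inr]
    rw [← hv]
    rw [← hS] at hrm
    clear hv hr
    induction hrm using Submodule.span_induction with
    | mem x hx => exact Submodule.subset_span (Finset.mem_coe.2 (Finset.mem_image_of_mem _ hx))
    | zero => simp
    | add x y _ _ hx hy => simpa using Submodule.add_mem _ hx hy
    -- As `(ψ x).fst = 0`, only `(ψ a).fst • (ψ x).snd` survives in the product.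
    | smul a x hx hmem =>
      rw [hS] at hx
      simpa [hfst x hx] using Submodule.smul_mem _ _ hmem
  calc Module.finrank K V = Module.finrank K (⊤ : Submodule K V) := finrank_top K V |>.symm
    _ ≤ (S.image fun r => (ψ r).snd).card := htop ▸ finrank_span_finset_le_card _
    _ ≤ S.card := Finset.card_image_le
    _ = _ := hcard

namespace SeparatingIdeal

variable {K : Type*} [Field K] {n s : ℕ}

/-- The vector of coefficients of degree one of a polynomial. -/
noncomputable def linearCoeffs : MvPolynomial (Fin n) K →ₗ[K] (Fin n → K) :=
  LinearMap.pi fun i => lcoeff K (Finsupp.single i 1)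

@[simp]
theorem linearCoeffs_apply (f : MvPolynomial (Fin n) K) (i : Fin n) :
    linearCoeffs f i = coeff (Finsupp.single i 1) f := rfl

theorem linearCoeffs_homogeneousComponent (f : MvPolynomial (Fin n) K) :
    linearCoeffs (homogeneousComponent 1 f) = linearCoeffs f := by
  ext i
  simp [coeff_homogeneousComponent]

theorem linearCoeffs_mul_X (f : MvPolynomial (Fin n) K) (k : Fin n) :
    linearCoeffs (f * X k) = coeff 0 f • Pi.single k 1 := by
  ext i
  by_cases h : i = k
  · subst h
    simp [coeff_mul_X']
  · simp [coeff_mul_X', h, Ne.symm h]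

theorem finrank_map_linearCoeffs (I : Ideal (MvPolynomial (Fin n) K)) :
    Module.finrank K ((linearPart I).map linearCoeffs) = Module.finrank K (linearPart I) := by
  refine (LinearEquiv.finrank_eq ((LinearEquiv.ofInjective
    ((linearCoeffs (K := K)).domRestrict (linearPart I)) ?_).trans
    (LinearEquiv.ofEq _ _ (LinearMap.range_domRestrict _ _)))).symm
  rw [← LinearMap.ker_eq_bot, LinearMap.ker_eq_bot']
  rintro ⟨f, hf⟩ h0
  have hle : linearPart I ≤ homogeneousSubmodule (Fin n) K 1 := by
    rw [linearPart, Submodule.span_le]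
    rintro _ ⟨g, -, rfl⟩
    exact homogeneousComponent_mem 1 g
  have hhom : f.IsHomogeneous 1 := hle hf
  ext d
  by_contra hd
  have hdeg : d.degree = 1 := by rw [Finsupp.degree_eq_weight_one]; exact hhom hd
  obtain ⟨i, rfl⟩ := (Finsupp.sum_eq_one_iff d).1 hdeg
  exact hd (congrFun h0 i)

/-- The first order Taylor expansion at the origin, followed by a linear map on linear forms. -/
noncomputable def firstOrderHom {m : ℕ} (q : (Fin n → K) →ₗ[K] (Fin m → K)) :
    MvPolynomial (Fin n) K →ₐ[K] TrivSqZeroExt K (Fin m → K) :=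
  aeval fun i => TrivSqZeroExt.inr (q (Pi.single i 1))

theorem firstOrderHom_apply {m : ℕ} (q : (Fin n → K) →ₗ[K] (Fin m → K))
    (f : MvPolynomial (Fin n) K) :
    firstOrderHom q f = TrivSqZeroExt.inl (coeff 0 f) + TrivSqZeroExt.inr (q (linearCoeffs f)) := by
  induction f using MvPolynomial.induction_on with
  | C a =>
    have : linearCoeffs (C a : MvPolynomial (Fin n) K) = 0 := by
      ext i
      simp [coeff_C, eq_comm]
    simp [firstOrderHom, this, TrivSqZeroExt.algebraMap_eq_inl]
  | add f g hf hg =>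
    rw [map_add, hf, hg]
    ext <;> simp
  | mul_X f k hf =>
    rw [map_mul, hf, linearCoeffs_mul_X]
    ext <;> simp [firstOrderHom, coeff_mul_X']

theorem firstOrderHom_surjective {m : ℕ} {q : (Fin n → K) →ₗ[K] (Fin m → K)}
    (hq : Function.Surjective q) : Function.Surjective (firstOrderHom q) := by
  intro x
  obtain ⟨w, hw⟩ := hq x.snd
  have hX : firstOrderHom q (∑ i, C (w i) * X i) = TrivSqZeroExt.inr x.snd := by
    rw [firstOrderHom_apply, map_sum]
    simp only [linearCoeffs_mul_X, coeff_zero_C]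
    rw [← pi_eq_sum_univ' w, hw]
    simp [coeff_sum]
  refine ⟨C x.fst + ∑ i, C (w i) * X i, ?_⟩
  rw [map_add, hX]
  ext <;> simp [firstOrderHom, TrivSqZeroExt.algebraMap_eq_inl]

theorem isUnit_firstOrderHom {m : ℕ} (q : (Fin n → K) →ₗ[K] (Fin m → K))
    (f : (idealOfVars (Fin n) K).primeCompl) : IsUnit (firstOrderHom q f) := by
  rw [TrivSqZeroExt.isUnit_iff_isUnit_fst, firstOrderHom_apply]
  have := mt mem_idealOfVars_iff.2 f.2
  simpa using this

/-- With `W` the coefficient vectors of `Lin_𝔐(I)`, the Taylor map to `K ⊕ Kⁿ/W` kills `I` and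
inverts the complement of `𝔐`, so it factors through the local ring. -/
theorem le_finrank_linearPart_add_spanFinrank {I : Ideal (MvPolynomial (Fin n) K)}
    (hI : I ≤ idealOfVars (Fin n) K) [IsLocalRing (LocalQuotient I)] :
    n ≤ Module.finrank K (linearPart I) +
      (IsLocalRing.maximalIdeal (LocalQuotient I)).spanFinrank := by
  set W := (linearPart I).map linearCoeffs with hW
  let e := (Module.finBasis K ((Fin n → K) ⧸ W)).equivFun
  let q := e.toLinearMap ∘ₗ W.mkQ
  have hq : Function.Surjective q := e.surjective.comp W.mkQ_surjective
  let ψ₀ := IsLocalization.lift (M := (idealOfVars (Fin n) K).primeCompl)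
    (S := Localization.AtPrime (idealOfVars (Fin n) K)) (g := (firstOrderHom q).toRingHom)
    (isUnit_firstOrderHom q)
  have hψ₀ : ∀ f, ψ₀ (algebraMap _ _ f) = firstOrderHom q f := fun f =>
    IsLocalization.lift_eq _ f
  have hker : ∀ x ∈ I.map (algebraMap (MvPolynomial (Fin n) K)
      (Localization.AtPrime (idealOfVars (Fin n) K))), ψ₀ x = 0 := by
    intro x hx
    rw [← RingHom.mem_ker]
    refine Ideal.map_le_iff_le_comap.2 (fun f hf => ?_) hx
    rw [Ideal.mem_comap, RingHom.mem_ker, hψ₀, firstOrderHom_apply,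
      mem_idealOfVars_iff.1 (hI hf)]
    have : linearCoeffs f ∈ W := by
      rw [← linearCoeffs_homogeneousComponent]
      exact Submodule.mem_map_of_mem (Submodule.subset_span ⟨f, hf, rfl⟩)
    have : q (linearCoeffs f) = 0 := by simp [q, this]
    simp [this]
  let ψ : LocalQuotient I →+* TrivSqZeroExt K (Fin _ → K) := Ideal.Quotient.lift _ ψ₀ hker
  have hψ : Function.Surjective ψ := by
    intro x
    obtain ⟨f, rfl⟩ := firstOrderHom_surjective hq x
    exact ⟨Ideal.Quotient.mk _ (algebraMap _ _ f), by rw [Ideal.Quotient.lift_mk, hψ₀]⟩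
  have h1 := IsLocalRing.finrank_le_spanFinrank_maximalIdeal (R := LocalQuotient I) (K := K)
    (V := Fin _ → K) ψ hψ
  have h2 := W.finrank_quotient_add_finrank
  rw [hW, finrank_map_linearCoeffs, ← hW, Module.finrank_fin_fun] at h2
  rw [Module.finrank_fin_fun] at h1
  omega

end SeparatingIdeal

/-! ### Dimension of localizations, and affine spaces as spectra. -/

theorem IsLocalization.ringKrullDim_le {R : Type*} [CommRing R] (M : Submonoid R) (A : Type*)
    [CommRing A] [Algebra R A] [IsLocalization M A] : ringKrullDim A ≤ ringKrullDim R := by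
  rw [ringKrullDim_le_iff_height_le]
  intro p hp
  rw [← IsLocalization.height_under M p]
  exact Ideal.height_le_ringKrullDim_of_isPrime

/-- An isomorphism with a polynomial ring induces an isomorphism of the spectrum with an affine
space over the base. -/
theorem AlgebraicGeometry.AffineSpace.exists_spec_iso {R A : Type u} [CommRing R] [CommRing A]
    [Algebra R A] {ι : Type u} (e : A ≃ₐ[R] MvPolynomial ι R) :
    ∃ φ : Spec (CommRingCat.of A) ≅ AffineSpace ι (Spec (CommRingCat.of R)),
      φ.hom ≫ (AffineSpace ι (Spec (CommRingCat.of R)) ↘ Spec (CommRingCat.of R)) =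
        Spec.map (CommRingCat.ofHom (algebraMap R A)) := by
  refine ⟨(Scheme.Spec.mapIso e.symm.toRingEquiv.toCommRingCatIso.op) ≪≫
    (AffineSpace.SpecIso ι (CommRingCat.of R)).symm, ?_⟩
  rw [Iso.trans_hom, Category.assoc, Iso.symm_hom, AffineSpace.SpecIso_inv_over]
  simp only [Functor.mapIso_hom, Iso.op_hom, Scheme.Spec_map, Quiver.Hom.unop_op]
  rw [← Spec.map_comp]
  congr 1
  ext x
  exact e.symm.commutes x

/-! ### The homomorphism `P̂ → P/I` and the criterion. -/

namespace SeparatingIdeal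

variable {K : Type*} [Field K] {n s : ℕ}

/-- `K[X ∖ Z]` is a polynomial ring in `n - s` indeterminates. -/
theorem nonempty_remainingPoly_algEquiv {z : Fin s → Fin n} (hz : Function.Injective z) :
    Nonempty (remainingPoly K z ≃ₐ[K] MvPolynomial (Fin (n - s)) K) := by
  have hcard : Nat.card ((Set.range z)ᶜ : Set (Fin n)) = n - s := by
    classical
    rw [Nat.card_eq_fintype_card, Fintype.card_compl_set, Set.card_range_of_injective hz]
    simp
  exact ⟨(supportedEquivMvPolynomial _).trans (renameEquiv K (Finite.equivFinOfCardEq hcard))⟩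

variable {z : Fin s → Fin n} {I : Ideal (MvPolynomial (Fin n) K)}

variable (z I) in
/-- The canonical homomorphism `K[X ∖ Z] → P/I`. -/
noncomputable def remainingPolyToQuotient : remainingPoly K z →ₐ[K] MvPolynomial (Fin n) K ⧸ I :=
  (Ideal.Quotient.mkₐ K I).comp (remainingPoly K z).val

/-- For the last clause: the remainder of an element of `I` lies in `I ∩ P̂ = 0`, so the separating
family generates `I`. -/
theorem IsSeparatingOrder.exists_sub_mem {σ : MonomialOrder.{0, 0} (Fin n)}
    (hI : I ≤ idealOfVars (Fin n) K) (hσ : IsSeparatingOrder σ z I) :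
    ∃ h : Fin s → remainingPoly K z,
      (∀ j, X (z j) - (h j : MvPolynomial (Fin n) K) ∈ I) ∧
      (∀ j, σ.degree (X (z j) - (h j : MvPolynomial (Fin n) K)) = Finsupp.single (z j) 1) ∧
      (∀ j, σ.Monic (X (z j) - (h j : MvPolynomial (Fin n) K))) ∧
      (elimIdeal z I = ⊥ →
        leadingTermIdeal σ I = Ideal.span (Set.range fun j => X (z j))) := by
  obtain ⟨f, hf, hLT⟩ := hσ
  have hfI : Ideal.span (Set.range f) ≤ I :=
    Ideal.span_le.2 (Set.range_subset_iff.2 fun j => (hf j).1)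
  choose h hmem hdeg hmonic using exists_sub_mem_of_leadingTermIdeal_eq (hfI.trans hI) hLT
  refine ⟨h, fun j => hfI (hmem j), hdeg, hmonic, fun hbot => ?_⟩
  suffices I = Ideal.span (Set.range f) by rw [this, hLT]
  refine le_antisymm (fun p hp => ?_) hfI
  obtain ⟨r, hr⟩ := exists_remainder (fun j => (hmonic j).ne_zero) hdeg p
  replace hr := Ideal.span_le.2 (Set.range_subset_iff.2 hmem) hr
  have hrI : r ∈ elimIdeal z I := by
    rw [Ideal.mem_comap]
    simpa using I.sub_mem hp (hfI hr)
  rw [hbot, Ideal.mem_bot] at hrI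
  simpa [hrI] using hr

theorem remainingPolyToQuotient_surjective (hI : I ≤ idealOfVars (Fin n) K)
    (hsep : IsSeparating z I) : Function.Surjective (remainingPolyToQuotient z I) := by
  obtain ⟨σ, hσ⟩ := hsep
  obtain ⟨h, hmem, hdeg, hmonic, -⟩ := hσ.exists_sub_mem hI
  intro x
  obtain ⟨p, rfl⟩ := Ideal.Quotient.mk_surjective x
  obtain ⟨r, hr⟩ := exists_remainder (fun j => (hmonic j).ne_zero) hdeg p
  exact ⟨r, (Ideal.Quotient.eq.2 (Ideal.span_le.2 (Set.range_subset_iff.2 hmem) hr)).symm⟩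

theorem remainingPolyToQuotient_eq_zero_iff (r : remainingPoly K z) :
    remainingPolyToQuotient z I r = 0 ↔ r ∈ elimIdeal z I :=
  Ideal.Quotient.eq_zero_iff_mem

/-- Since `I ∩ P̂ = 0`, the reduced basis is just the `zⱼ - hⱼ`, with no `g`. -/
theorem isReembedding_symm (hI : I ≤ idealOfVars (Fin n) K) (hz : Function.Injective z)
    (hbot : elimIdeal z I = ⊥) (Φ : (MvPolynomial (Fin n) K ⧸ I) ≃ₐ[K] remainingPoly K z)
    (hΦ : ∀ r, Φ (remainingPolyToQuotient z I r) = r)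
    {σ : MonomialOrder.{0, 0} (Fin n)} (hσ : IsSeparatingOrder σ z I) :
    IsReembedding σ z I
      ((Ideal.Quotient.mkₐ K (elimIdeal z I)).comp (Φ : _ →ₐ[K] remainingPoly K z)) := by
  obtain ⟨h, hmem, hdeg, hmonic, hLT⟩ := hσ.exists_sub_mem hI
  have hlt : ∀ j, σ.leadingTerm (X (z j) - (h j : MvPolynomial (Fin n) K)) = X (z j) := by
    intro j
    rw [MonomialOrder.leadingTerm, hdeg, (hmonic j).leadingCoeff_eq_one, X]
  refine ⟨h, ∅, ⟨?_, ?_, ?_, ?_⟩, fun i hi => ?_, fun j => ?_⟩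
  · rw [Set.image_empty, Set.union_empty]
    exact Set.range_subset_iff.2 hmem
  · rw [Set.image_empty, Set.union_empty]
    exact Set.forall_mem_range.2 hmonic
  · rw [Set.image_empty, Set.union_empty, hLT hbot, ← Set.range_comp]
    exact congrArg _ (congrArg _ (funext hlt))
  · rw [Set.image_empty, Set.union_empty]
    rintro _ ⟨j, rfl⟩ _ ⟨k, rfl⟩ hkj t ht hle
    have hjk : z j ≠ z k := fun h => hkj (by rw [hz h])
    rw [hdeg, Finsupp.single_le_iff] at hle
    -- A term divisible by `z k` cannot come from `h j`, so it is `z j` itself, which forces `z j =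
    -- z k`.
    have ht' : t ∉ (h j : MvPolynomial (Fin n) K).support := fun h' => by
      have := mem_remainingPoly_iff.1 (h j).2 t h' k
      omega
    rw [mem_support_iff, coeff_sub, notMem_support_iff.1 ht', sub_zero, coeff_X] at ht
    have hts : Finsupp.single (z j) 1 = t := by
      by_contra hne
      exact ht (if_neg hne)
    rw [← hts, Finsupp.single_eq_of_ne (Ne.symm hjk)] at hle
    omega
  · exact congrArg (Ideal.Quotient.mk _) (hΦ ⟨X i, X_mem_supported.2 hi⟩)
  · refine congrArg (Ideal.Quotient.mk _) ((congrArg Φ ?_).trans (hΦ (h j)))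
    exact Ideal.Quotient.eq.2 (hmem j)

theorem ringKrullDim_remainingPoly (hz : Function.Injective z) :
    ringKrullDim (remainingPoly K z) = ((n - s : ℕ) : WithBot ℕ∞) := by
  obtain ⟨e⟩ := nonempty_remainingPoly_algEquiv (K := K) hz
  rw [ringKrullDim_eq_of_ringEquiv e.toRingEquiv, MvPolynomial.ringKrullDim_of_isNoetherianRing,
    ringKrullDim_eq_zero_of_field]
  simp

theorem ringKrullDim_localQuotient_le (I : Ideal (MvPolynomial (Fin n) K)) :
    ringKrullDim (LocalQuotient I) ≤ ringKrullDim (MvPolynomial (Fin n) K ⧸ I) :=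
  IsLocalization.ringKrullDim_le (Algebra.algebraMapSubmonoid (MvPolynomial (Fin n) K ⧸ I)
    (idealOfVars (Fin n) K).primeCompl) (LocalQuotient I)

theorem ringKrullDim_localQuotient (hz : Function.Injective z) (hI : I ≤ idealOfVars (Fin n) K)
    (hsep : IsSeparating z I) (hreg : IsRegularLocalRing (LocalQuotient I))
    (hlin : Module.finrank K (linearPart I) = s) :
    ringKrullDim (LocalQuotient I) = ((n - s : ℕ) : WithBot ℕ∞) := by
  refine le_antisymm ?_ ?_
  · rw [← ringKrullDim_remainingPoly (K := K) hz]
    exact (ringKrullDim_localQuotient_le I).trans (ringKrullDim_le_of_surjective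
      (remainingPolyToQuotient z I).toRingHom (remainingPolyToQuotient_surjective hI hsep))
  · have := hreg.toIsLocalRing
    rw [← hreg.spanFinrank_maximalIdeal]
    have := le_finrank_linearPart_add_spanFinrank hI
    rw [hlin] at this
    exact_mod_cast Nat.sub_le_iff_le_add'.2 this

/-- A nonzero `r ∈ I ∩ P̂` is a nonzerodivisor of `P̂` killed in `P/I`, giving `dim P/I + 1 ≤ n -
s`, whereas `n - s = dim P_𝔐/I_𝔐 ≤ dim P/I`. -/
theorem elimIdeal_eq_bot (hz : Function.Injective z) (hI : I ≤ idealOfVars (Fin n) K)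
    (hsep : IsSeparating z I) (hreg : IsRegularLocalRing (LocalQuotient I))
    (hlin : Module.finrank K (linearPart I) = s) : elimIdeal z I = ⊥ := by
  refine (Submodule.eq_bot_iff _).2 fun r hr => ?_
  by_contra h0
  have h1 := ringKrullDim_succ_le_of_surjective (remainingPolyToQuotient z I).toRingHom
    (remainingPolyToQuotient_surjective hI hsep) (mem_nonZeroDivisors_of_ne_zero h0)
    ((remainingPolyToQuotient_eq_zero_iff r).2 hr)
  have h2 := ringKrullDim_localQuotient_le I
  rw [ringKrullDim_localQuotient hz hI hsep hreg hlin] at h2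
  rw [ringKrullDim_remainingPoly hz] at h1
  have h3 : ((n - s : ℕ) : WithBot ℕ∞) + 1 ≤ ((n - s : ℕ) : WithBot ℕ∞) :=
    (add_le_add_left h2 1).trans h1
  have h4 : (n - s) + 1 ≤ n - s := by exact_mod_cast h3
  omega

end SeparatingIdeal

theorem mainTheorem5 {K : Type u} [Field K] {n s : ℕ}
    (z : Fin s → Fin n) (hz : Function.Injective z)
    (I : Ideal (MvPolynomial (Fin n) K)) (hI : I ≤ idealOfVars (Fin n) K)
    (hsep : IsSeparating z I)
    (hreg : IsRegularLocalRing (LocalQuotient I))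
    (hlin : Module.finrank K (linearPart I) = s) :
    ((s : WithBot ℕ∞) + ringKrullDim (LocalQuotient I) = n) ∧
    elimIdeal z I = ⊥ ∧
    (∃ Φ : (MvPolynomial (Fin n) K ⧸ I) ≃ₐ[K] remainingPoly K z,
      ∀ σ : MonomialOrder.{0, 0} (Fin n), IsSeparatingOrder σ z I →
        IsReembedding σ z I
          ((Ideal.Quotient.mkₐ K (elimIdeal z I)).comp (Φ : _ →ₐ[K] remainingPoly K z))) ∧
    Nonempty ((MvPolynomial (Fin n) K ⧸ I) ≃ₐ[K] MvPolynomial (Fin (n - s)) K) ∧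
    ∃ e : Spec (CommRingCat.of (MvPolynomial (Fin n) K ⧸ I)) ≅
        AffineSpace (ULift.{u} (Fin (n - s))) (Spec (CommRingCat.of K)),
      e.hom ≫ (AffineSpace (ULift.{u} (Fin (n - s))) (Spec (CommRingCat.of K)) ↘
          Spec (CommRingCat.of K)) =
        Spec.map (CommRingCat.ofHom (algebraMap K (MvPolynomial (Fin n) K ⧸ I))) := by
  have hsn : s ≤ n := by simpa using Fintype.card_le_of_injective z hz
  have hbot := elimIdeal_eq_bot hz hI hsep hreg hlin
  have hinj : Function.Injective (remainingPolyToQuotient z I) := by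
    rw [injective_iff_map_eq_zero]
    intro r hr
    rwa [remainingPolyToQuotient_eq_zero_iff, hbot, Ideal.mem_bot] at hr
  let Ψ := AlgEquiv.ofBijective (remainingPolyToQuotient z I)
    ⟨hinj, remainingPolyToQuotient_surjective hI hsep⟩
  obtain ⟨e⟩ := nonempty_remainingPoly_algEquiv (K := K) hz
  refine ⟨?_, hbot, ⟨Ψ.symm, fun σ hσ => isReembedding_symm hI hz hbot _
    (fun r => Ψ.symm_apply_apply r) hσ⟩, ⟨Ψ.symm.trans e⟩,
    AffineSpace.exists_spec_iso ((Ψ.symm.trans e).trans (renameEquiv K Equiv.ulift.symm))⟩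
  rw [ringKrullDim_localQuotient hz hI hsep hreg hlin]
  exact_mod_cast Nat.add_sub_of_le hsn
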